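/- Theorem. Multigraphs are finite; parallel edges are allowed and loops are not. A multigraph $H$ is \emph{2-connected} if it is connected and $H-v$ is connected for every node $v$ (a graph without nodes is not connected), and \emph{hypomatchable} if for every node $v$ the graph $H-v$ has a perfect matching. An \emph{odd hole} is a cycle $C_{2k+1}$ with $k\ge 2$. Let $H$ be a 2-connected hypomatchable multigraph. Then exactly one of the following three conditions holds: 1. $H$ has exactly three nodes; 2. $H$ is an odd hole; 3. $H$ contains, as a not necessarily induced subgraph, at least one of the following: (a) an odd hole with one double edge, that is, an odd hole together with one additional edge parallel to an edge of the hole; (b) an odd hole with one chord, that is, an odd hole together with one additional edge joining two distinct nodes that are non-adjacent in the hole; (c) an odd hole with one long ear attached to non-adjacent nodes, that is, an odd hole together with a path of odd length at least three whose two ends are distinct nodes that are non-adjacent in the hole and whose internal nodes lie outside the hole. -/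

import Mathlib

open scoped Graph

namespace Graph

/-- A multigraph is connected if it has a node and any two of its nodes are joined by a walk. -/
def IsConnected {α β : Type*} (G : Graph α β) : Prop :=
  V(G).Nonempty ∧ ∀ x ∈ V(G), ∀ y ∈ V(G), Relation.ReflTransGen G.Adj x y

/-- A multigraph is 2-connected if it is connected and remains connected after removing an
arbitrary node. (The graph without nodes is not connected, so a one-node graph is not
2-connected.) -/
def IsTwoConnected {α β : Type*} (G : Graph α β) : Prop :=
  G.IsConnected ∧ ∀ v ∈ V(G), (G.deleteVerts {v}).IsConnected

/-- A perfect matching: a set of non-loop edges such that every node is an end of exactly one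
of them. -/
def IsPerfectMatching {α β : Type*} (G : Graph α β) (M : Set β) : Prop :=
  M ⊆ E(G) ∧ (∀ e ∈ M, ∀ x, ¬ G.IsLoopAt e x) ∧ ∀ x ∈ V(G), ∃! e, e ∈ M ∧ G.Inc e x

/-- A multigraph is hypomatchable if deleting any node leaves a graph with a perfect matching. -/
def IsHypomatchable {α β : Type*} (G : Graph α β) : Prop :=
  ∀ v ∈ V(G), ∃ M : Set β, (G.deleteVerts {v}).IsPerfectMatching M

/-- `G` is a cycle with `n ≥ 3` nodes: distinct nodes `v i` and distinct edges `e i`, indexed by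
the integers modulo `n`, where `e i` joins `v i` to `v (i + 1)`, and nothing else. -/
def IsCycleOfLength {α β : Type*} (G : Graph α β) (n : ℕ) : Prop :=
  3 ≤ n ∧ ∃ (v : ZMod n → α) (e : ZMod n → β), Function.Injective v ∧ Function.Injective e ∧
    V(G) = Set.range v ∧ E(G) = Set.range e ∧ ∀ i, G.IsLink (e i) (v i) (v (i + 1))

/-- `G` is an odd hole `C_{2k+1}` with `k ≥ 2`. -/
def IsOddHole {α β : Type*} (G : Graph α β) : Prop :=
  ∃ k : ℕ, 2 ≤ k ∧ G.IsCycleOfLength (2 * k + 1)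

/-- `G` is a path with `l` edges, from `x` to `y`: distinct nodes `v 0, …, v l` and distinct
edges `e i` joining `v i` to `v (i + 1)`, and nothing else. -/
def IsPathOfLength {α β : Type*} (G : Graph α β) (l : ℕ) (x y : α) : Prop :=
  ∃ (v : Fin (l + 1) → α) (e : Fin l → β), Function.Injective v ∧ Function.Injective e ∧
    v 0 = x ∧ v (Fin.last l) = y ∧ V(G) = Set.range v ∧ E(G) = Set.range e ∧
    ∀ i : Fin l, G.IsLink (e i) (v i.castSucc) (v i.succ)

/-- `K` is obtained from the odd hole `C` by attaching a path of length `l` to the distinct nodes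
`x`, `y` of `C`: the path uses no edge of `C` and its internal nodes lie outside `C`. -/
def IsOddHoleWithPath {α β : Type*} (K C : Graph α β) (l : ℕ) (x y : α) : Prop :=
  C.IsOddHole ∧ C ≤ K ∧ x ≠ y ∧ ∃ P : Graph α β, P ≤ K ∧ P.IsPathOfLength l x y ∧
    V(C) ∩ V(P) = {x, y} ∧ Disjoint E(C) E(P) ∧ V(K) = V(C) ∪ V(P) ∧ E(K) = E(C) ∪ E(P)

/-- `K` is an odd hole with one double edge: one extra edge parallel to an edge of the hole. -/
def IsOddHoleWithDoubleEdge {α β : Type*} (K : Graph α β) : Prop :=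
  ∃ (C : Graph α β) (x y : α), K.IsOddHoleWithPath C 1 x y ∧ C.Adj x y

/-- `K` is an odd hole with one chord: one extra edge joining non-adjacent nodes of the hole. -/
def IsOddHoleWithChord {α β : Type*} (K : Graph α β) : Prop :=
  ∃ (C : Graph α β) (x y : α), K.IsOddHoleWithPath C 1 x y ∧ ¬ C.Adj x y

/-- `K` is an odd hole with one long ear attached to non-adjacent nodes of the hole; a long ear is
a path of odd length at least three. -/
def IsOddHoleWithLongEar {α β : Type*} (K : Graph α β) : Prop :=
  ∃ (C : Graph α β) (l : ℕ) (x y : α), Odd l ∧ 3 ≤ l ∧ K.IsOddHoleWithPath C l x y ∧ ¬ C.Adj x y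

end Graph

/-!
The three conditions exclude each other because an odd hole has at least five nodes and because a
cycle has no proper subgraph that is a cycle (`Graph.IsCycleOfLength.edgeSet_subset_of_le`), so that
an odd hole leaves no edge for a path attached to another odd hole inside it.

For the existence part, parallel edges are first ignored. An *odd theta* in the underlying simple
graph consists of three paths from `x` to `y` with disjoint interiors, two of them odd, one of these
of length at least three, and the third even. The even path and the long odd path form an odd hole
in which `x` and `y` are not adjacent, and the other odd path is a chord or a long ear of it. Thus
it suffices to show that the underlying simple graph of a 2-connected hypomatchable multigraph
contains an odd theta or is an odd cycle (`SimpleGraph.hasOddTheta_or_isHamiltonian_odd_cycle`). In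
the second case the multigraph has three nodes, or it is an odd hole, or it has an edge parallel to
an edge of a spanning odd hole.

To find a theta, tree-like unions of odd cycles are grown by adding closed odd ears. Their node sets
`Q` satisfy `SimpleGraph.CycleLinked`: for distinct `a`, `b` in `Q` there is an odd cycle through
`a` and some `c ≠ a`, followed by an even path from `c` to `b`. Consequently an odd path from `a` to
`b` outside `Q` completes the two paths of the cycle between `a` and `c` to an odd theta, provided
that it has length at least three or `b ≠ c` (`SimpleGraph.hasOddTheta_of_ear`). Starting with a
single node, keep a perfect matching `M` of the complement of `Q`. If `Q` is not everything, let
`xy` be an edge leaving `Q` at `x` and follow `M` and a perfect matching of the graph without `y`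
alternately, from `y` until `Q` is reached at some `z`
(`SimpleGraph.MatchesOff.exists_alternating_path`). If `z ≠ x`, this is an odd ear of length at
least three and gives a theta. If `z = x`, it is an odd cycle `C` meeting `Q` in `x` only, which is
added to `Q`. When finally `Q` and `C` cover all nodes, either `Q = {x}` and `C` is a Hamiltonian
odd cycle, any chord of which gives a theta, or by 2-connectedness an edge joins `C - x` to `Q - x`,
which also gives a theta.
-/

/-! ### Definitions -/

namespace SimpleGraph

variable {W : Type*} {G : SimpleGraph W}

/-- Two walks with the same ends share no node except these ends. -/
def Walk.InternallyDisjoint {a b : W} (p q : G.Walk a b) : Prop :=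
  ∀ v ∈ p.support, v ∈ q.support → v = a ∨ v = b

/-- There are three internally disjoint paths with the same distinct ends: `p` of odd length, `q` of
even length, and `r` of odd length at least three. The bound on `r` makes `q` and `r` together an
odd cycle of length at least five. -/
def HasOddTheta (G : SimpleGraph W) : Prop :=
  ∃ (a b : W) (p q r : G.Walk a b), a ≠ b ∧ p.IsPath ∧ q.IsPath ∧ r.IsPath ∧
    Odd p.length ∧ Even q.length ∧ Odd r.length ∧ 3 ≤ r.length ∧
    p.InternallyDisjoint q ∧ p.InternallyDisjoint r ∧ q.InternallyDisjoint r

/-- Within `Q` there are an odd cycle through `a` and a node `c ≠ a`, given by its paths `p` and `q`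
from `a` to `c`, and a path `s` of even length (possibly zero) from `c` to `b` which meets the cycle
only in `c`. -/
def CycleLinkedTo (G : SimpleGraph W) (Q : Set W) (a b : W) : Prop :=
  ∃ (c : W) (p q : G.Walk a c) (s : G.Walk c b), a ≠ c ∧
    p.IsPath ∧ q.IsPath ∧ s.IsPath ∧ Odd p.length ∧ Even q.length ∧ Even s.length ∧
    p.InternallyDisjoint q ∧ (∀ v ∈ s.support, v ∈ p.support ∨ v ∈ q.support → v = c) ∧
    (∀ v ∈ p.support, v ∈ Q) ∧ (∀ v ∈ q.support, v ∈ Q) ∧ ∀ v ∈ s.support, v ∈ Q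

/-- Any ordered pair of distinct nodes of `Q` is linked by an odd cycle followed by an even path.
This is what is used of the node sets of tree-like unions of odd cycles, any two of which share at
most one node. -/
def CycleLinked (G : SimpleGraph W) (Q : Set W) : Prop :=
  ∀ a ∈ Q, ∀ b ∈ Q, a ≠ b → G.CycleLinkedTo Q a b

/-- `m` is a perfect matching of the complement of `Q`, given as the map sending each node to its
partner. The values of `m` on `Q` are irrelevant. -/
def MatchesOff (G : SimpleGraph W) (m : W → W) (Q : Set W) : Prop :=
  ∀ u ∉ Q, m u ∉ Q ∧ G.Adj u (m u) ∧ m (m u) = u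

/-! ### Paths and odd cycles -/

theorem Walk.IsPath.append_of_inter {a b c : W} {p : G.Walk a b} {q : G.Walk b c}
    (hp : p.IsPath) (hq : q.IsPath) (h : ∀ v ∈ p.support, v ∈ q.support → v = b) :
    (p.append q).IsPath := by
  rw [Walk.isPath_def, Walk.support_append, List.nodup_append']
  refine ⟨hp.support_nodup, hq.support_nodup.tail, fun v hv hv' => ?_⟩
  obtain rfl := h v hv (List.mem_of_mem_tail hv')
  have := hq.support_nodup
  rw [← Walk.cons_tail_support, List.nodup_cons] at this
  exact this.1 hv'

/-- Two distinct nodes of an odd cycle divide it into a path of odd and a path of even length. -/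
theorem Walk.IsCycle.exists_paths_of_odd {x a b : W} {C : G.Walk x x} (hC : C.IsCycle)
    (hodd : Odd C.length) (ha : a ∈ C.support) (hb : b ∈ C.support) (hab : a ≠ b) :
    ∃ p q : G.Walk a b, p.IsPath ∧ q.IsPath ∧ Odd p.length ∧ Even q.length ∧
      p.InternallyDisjoint q ∧ (∀ v ∈ p.support, v ∈ C.support) ∧
      (∀ v ∈ q.support, v ∈ C.support) ∧ (p.length = 1 → s(a, b) ∈ C.edges) := by
  classical
  have hD : (C.rotate a ha).IsCycle := hC.rotate ha
  have hb' : b ∈ (C.rotate a ha).support := by rwa [Walk.mem_support_rotate_iff]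
  obtain ⟨p, q, hpq⟩ := Walk.mem_support_iff_exists_append.1 hb'
  have hlen : p.length + q.length = C.length := by
    rw [← Walk.length_append, ← hpq, Walk.length_rotate]
  have hsup : ∀ v, v ∈ p.support ∨ v ∈ q.support → v ∈ C.support := by
    intro v hv
    rw [← Walk.mem_support_rotate_iff C a ha, hpq, Walk.mem_support_append_iff]
    exact hv
  have hedge : ∀ e, e ∈ p.edges ∨ e ∈ q.edges → e ∈ C.edges := by
    intro e he
    rw [← (C.rotate_edges a ha).perm.mem_iff, hpq, Walk.edges_append, List.mem_append]
    exact he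
  rw [hpq] at hD
  have hp := hD.isPath_of_append_left (Walk.not_nil_of_ne hab.symm)
  have hq := hD.isPath_of_append_right (Walk.not_nil_of_ne hab)
  have hdis : p.InternallyDisjoint q.reverse := by
    intro v hv hv'
    by_contra! hne
    have hnd := hD.support_nodup
    rw [Walk.tail_support_append, List.nodup_append'] at hnd
    rw [Walk.support_reverse, List.mem_reverse] at hv'
    refine hnd.2.2 ((Walk.mem_support_iff p).1 hv |>.resolve_left hne.1)
      ((Walk.mem_support_iff q).1 hv' |>.resolve_left hne.2)
  have hone : ∀ {u v : W} (w : G.Walk u v), w.length = 1 → s(u, v) ∈ w.edges := by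
    intro u v w hw
    cases w with
    | nil => simp at hw
    | cons h w' =>
      cases w' with
      | nil => simp
      | cons _ _ => simp at hw
  rw [← hlen, Nat.odd_add] at hodd
  rcases Nat.even_or_odd q.length with hqe | hqo
  · refine ⟨p, q.reverse, hp, hq.reverse, hodd.2 hqe, by simpa using hqe, hdis,
      fun v hv => hsup v (.inl hv), fun v hv => hsup v (.inr (by simpa using hv)),
      fun h => hedge _ (.inl (hone p h))⟩
  · have hpe : Even p.length := by
      by_contra h
      exact Nat.not_even_iff_odd.2 hqo (hodd.1 (Nat.not_even_iff_odd.1 h))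
    refine ⟨q.reverse, p, hq.reverse, hp, by simpa using hqo, hpe, fun v hv hv' => hdis v hv' hv,
      fun v hv => hsup v (.inr (by simpa using hv)), fun v hv => hsup v (.inl hv), fun h => ?_⟩
    rw [Sym2.eq_swap]
    exact hedge _ (.inr (hone q (by simpa using h)))

/-! ### Cycle-linked sets -/

theorem CycleLinkedTo.mono {Q Q' : Set W} {a b : W} (h : G.CycleLinkedTo Q a b) (hQ : Q ⊆ Q') :
    G.CycleLinkedTo Q' a b := by
  obtain ⟨c, p, q, s, hac, hp, hq, hs, hpo, hqe, hse, hpq, hi, hpQ, hqQ, hsQ⟩ := h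
  exact ⟨c, p, q, s, hac, hp, hq, hs, hpo, hqe, hse, hpq, hi, fun v hv => hQ (hpQ v hv),
    fun v hv => hQ (hqQ v hv), fun v hv => hQ (hsQ v hv)⟩

theorem cycleLinkedTo_of_isCycle {x a b : W} {C : G.Walk x x} (hC : C.IsCycle)
    (hodd : Odd C.length) (ha : a ∈ C.support) (hb : b ∈ C.support) (hab : a ≠ b) :
    G.CycleLinkedTo {v | v ∈ C.support} a b := by
  obtain ⟨p, q, hp, hq, hpo, hqe, hpq, hpC, hqC, -⟩ := hC.exists_paths_of_odd hodd ha hb hab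
  exact ⟨b, p, q, .nil, hab, hp, hq, by simp, hpo, hqe, by simp, hpq, by simp, hpC, hqC,
    by simpa using hb⟩

theorem CycleLinked.exists_even_path {Q : Set W} (hQ : G.CycleLinked Q) {a b : W} (ha : a ∈ Q)
    (hb : b ∈ Q) : ∃ s : G.Walk a b, s.IsPath ∧ Even s.length ∧ ∀ v ∈ s.support, v ∈ Q := by
  by_cases hab : a = b
  · subst hab
    exact ⟨.nil, by simp, by simp, by simpa using ha⟩
  obtain ⟨c, p, q, s, hac, hp, hq, hs, hpo, hqe, hse, hpq, hint, hpQ, hqQ, hsQ⟩ := hQ a ha b hb hab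
  refine ⟨q.append s, hq.append_of_inter hs fun v hv hv' => hint v hv' (.inr hv),
    by simpa using hqe.add hse, fun v hv => ?_⟩
  rw [Walk.mem_support_append_iff] at hv
  exact hv.elim (hqQ v) (hsQ v)

/-- An odd cycle meeting `Q` in a single node can be added to `Q`. -/
theorem CycleLinked.union_cycle {Q : Set W} (hQ : G.CycleLinked Q) {x y : W} {C : G.Walk y y}
    (hC : C.IsCycle) (hodd : Odd C.length) (hxQ : x ∈ Q) (hxC : x ∈ C.support)
    (hint : ∀ v ∈ C.support, v ∈ Q → v = x) : G.CycleLinked (Q ∪ {v | v ∈ C.support}) := by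
  intro a ha b hb hab
  by_cases haQ : a ∈ Q
  · by_cases hbQ : b ∈ Q
    · exact (hQ a haQ b hbQ hab).mono Set.subset_union_left
    have hbC : b ∈ C.support := hb.resolve_left hbQ
    by_cases hax : a = x
    · exact (cycleLinkedTo_of_isCycle hC hodd (hax ▸ hxC) hbC hab).mono Set.subset_union_right
    -- link `a` to `x` in `Q` and go on along an even path of the new cycle
    obtain ⟨c, p, q, s, hac, hp, hq, hs, hpo, hqe, hse, hpq, hi, hpQ, hqQ, hsQ⟩ :=
      hQ a haQ x hxQ hax
    obtain ⟨-, t, -, ht, -, hte, -, -, htC, -⟩ :=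
      hC.exists_paths_of_odd hodd hxC hbC (fun h => hbQ (h ▸ hxQ))
    refine ⟨c, p, q, s.append t, hac, hp, hq,
      hs.append_of_inter ht fun v hv hv' => hint v (htC v hv') (hsQ v hv), hpo, hqe,
      by simpa using hse.add hte, hpq, fun v hv h => ?_, fun v hv => .inl (hpQ v hv),
      fun v hv => .inl (hqQ v hv), fun v hv => ?_⟩
    · rw [Walk.mem_support_append_iff] at hv
      refine hv.elim (fun hv => hi v hv h) fun hv => ?_
      have hvx : v = x := hint v (htC v hv) (h.elim (hpQ v) (hqQ v))
      exact hi v (hvx ▸ s.end_mem_support) h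
    · rw [Walk.mem_support_append_iff] at hv
      exact hv.elim (fun hv => .inl (hsQ v hv)) fun hv => .inr (htC v hv)
  have haC : a ∈ C.support := ha.resolve_left haQ
  by_cases hbC : b ∈ C.support
  · exact (cycleLinkedTo_of_isCycle hC hodd haC hbC hab).mono Set.subset_union_right
  -- use the new cycle with `c = x` and continue inside `Q`
  obtain ⟨p, q, hp, hq, hpo, hqe, hpq, hpC, hqC, -⟩ :=
    hC.exists_paths_of_odd hodd haC hxC fun h => haQ (h ▸ hxQ)
  obtain ⟨s, hs, hse, hsQ⟩ := hQ.exists_even_path hxQ (hb.resolve_right hbC)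
  exact ⟨x, p, q, s, fun h => haQ (h ▸ hxQ), hp, hq, hs, hpo, hqe, hse, hpq,
    fun v hv h => h.elim (fun h => hint v (hpC v h) (hsQ v hv))
      (fun h => hint v (hqC v h) (hsQ v hv)),
    fun v hv => .inr (hpC v hv), fun v hv => .inr (hqC v hv), fun v hv => .inl (hsQ v hv)⟩

/-! ### Alternating paths -/

/-- Starting at `y`, follow `M` and `N` alternately until `Q` is reached. No node is repeated, since
`M` and `N` are matchings, and the process can stop nowhere else, since only nodes of `Q` are missed
by `M` and only `y` is missed by `N`. The path obtained is a union of pairs matched by `M`, except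
for its end `z` in `Q`. -/
theorem MatchesOff.exists_alternating_path [Finite W] {Q : Set W} {M N : W → W} {y : W}
    (hM : G.MatchesOff M Q) (hN : G.MatchesOff N {y}) (hy : y ∉ Q) :
    ∃ z ∈ Q, ∃ p : G.Walk z y, p.IsPath ∧ Even p.length ∧ (∀ v ∈ p.support, v ∈ Q → v = z) ∧
      ∀ v ∈ p.support, v ∉ Q → M v ∈ p.support ∧ v ≠ z := by
  classical
  by_contra! hcon
  -- otherwise there are alternating paths outside `Q`, grown at the start `u`, of any even length:
  -- such a path is closed under `N` except at `y` and under `M` except at `u`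
  have main : ∀ n : ℕ, ∃ (u : W) (p : G.Walk u y), p.IsPath ∧ p.length = 2 * n ∧
      (∀ v ∈ p.support, v ∉ Q) ∧ (∀ v ∈ p.support, v ≠ u → M v ∈ p.support) ∧
      M u ∉ p.support ∧ ∀ v ∈ p.support, v ≠ y → N v ∈ p.support := by
    intro n
    induction n with
    | zero =>
      refine ⟨y, .nil, by simp, by simp, by simpa using hy, by simp, ?_, by simp⟩
      simpa using (hM y hy).2.1.ne'
    | succ n ih =>
      obtain ⟨u, p, hp, hpl, hpQ, hpM, huM, hpN⟩ := ih
      obtain ⟨h1, h2, h3⟩ := hM u (hpQ u p.start_mem_support)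
      have h4 : M u ≠ y := fun h => huM (h ▸ p.end_mem_support)
      obtain ⟨h5, h6, h7⟩ := hN (M u) h4
      have h8 : N (M u) ∉ p.support := fun h => huM (h7 ▸ hpN _ h h5)
      have hp1 : (Walk.cons h2.symm p).IsPath := hp.cons huM
      have hp2 : (Walk.cons h6.symm (Walk.cons h2.symm p)).IsPath :=
        hp1.cons (by simpa using ⟨h6.ne', h8⟩)
      by_cases hQ : N (M u) ∈ Q
      · exfalso
        obtain ⟨v, hv, hvQ, hv'⟩ := hcon _ hQ _ hp2 (by simp [hpl, parity_simps])
          (by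
            intro v hv hvQ
            simp only [Walk.support_cons, List.mem_cons] at hv
            rcases hv with rfl | rfl | hv
            · rfl
            · exact absurd hvQ h1
            · exact absurd hvQ (hpQ v hv))
        refine (fun h : v ≠ N (M u) => h (hv' ?_)) (fun h => hvQ (h ▸ hQ))
        simp only [Walk.support_cons, List.mem_cons] at hv ⊢
        rcases hv with rfl | rfl | hv
        · exact absurd hQ hvQ
        · simp [h3]
        · by_cases hvu : v = u
          · subst hvu; simp
          · exact .inr (.inr (hpM v hv hvu))
      · refine ⟨_, _, hp2, by simp [hpl]; ring, ?_, ?_, ?_, ?_⟩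
        · intro v hv
          simp only [Walk.support_cons, List.mem_cons] at hv
          rcases hv with rfl | rfl | hv
          exacts [hQ, h1, hpQ v hv]
        · intro v hv hne
          simp only [Walk.support_cons, List.mem_cons] at hv ⊢
          rcases hv with rfl | rfl | hv
          · exact absurd rfl hne
          · simp [h3]
          · by_cases hvu : v = u
            · subst hvu; simp
            · exact .inr (.inr (hpM v hv hvu))
        · obtain ⟨g1, g2, g3⟩ := hM _ hQ
          simp only [Walk.support_cons, List.mem_cons, not_or]
          refine ⟨g2.ne', fun h => ?_, fun h => ?_⟩
          · rw [h, h3] at g3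
            exact h8 (g3 ▸ p.start_mem_support)
          · by_cases hu : M (N (M u)) = u
            · rw [hu] at g3; exact h6.ne g3
            · exact h8 (g3 ▸ hpM _ h hu)
        · intro v hv hne
          simp only [Walk.support_cons, List.mem_cons] at hv ⊢
          rcases hv with rfl | rfl | hv
          · simp [h7]
          · simp
          · exact .inr (.inr (hpN v hv hne))
  have := Fintype.ofFinite W
  obtain ⟨u, p, hp, hpl, -⟩ := main (Fintype.card W)
  have := hp.length_lt
  omega

/-! ### Growing a cycle-linked set -/

/-- The three paths of the theta are `p`, `q`, and `r` followed by the reverse of `s`. -/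
theorem hasOddTheta_of_ear {a b c : W} {p q : G.Walk a c} {s : G.Walk c b} {r : G.Walk a b}
    (hac : a ≠ c) (hp : p.IsPath) (hq : q.IsPath) (hs : s.IsPath) (hr : r.IsPath)
    (hpo : Odd p.length) (hqe : Even q.length) (hse : Even s.length) (hro : Odd r.length)
    (hpq : p.InternallyDisjoint q) (hsc : ∀ v ∈ s.support, v ∈ p.support ∨ v ∈ q.support → v = c)
    (hrr : ∀ v ∈ r.support, v ∈ p.support ∨ v ∈ q.support ∨ v ∈ s.support → v = a ∨ v = b)
    (hlen : 3 ≤ r.length ∨ b ≠ c) : G.HasOddTheta := by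
  have hb : ∀ v, v ∈ p.support ∨ v ∈ q.support → v = b → v = c := fun v hv hvb =>
    hsc v (hvb ▸ s.end_mem_support) hv
  have ha : a ∉ s.support := fun h => hac (hsc a h (.inl p.start_mem_support))
  have hpath : (r.append s.reverse).IsPath := by
    refine hr.append_of_inter hs.reverse fun v hv hv' => ?_
    rw [Walk.support_reverse, List.mem_reverse] at hv'
    exact (hrr v hv (.inr (.inr hv'))).resolve_left fun h => ha (h ▸ hv')
  have hdis : ∀ v, v ∈ p.support ∨ v ∈ q.support → v ∈ (r.append s.reverse).support →
      v = a ∨ v = c := by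
    intro v hv hv'
    rw [Walk.mem_support_append_iff, Walk.support_reverse, List.mem_reverse] at hv'
    rcases hv' with hv' | hv'
    · exact (hrr v hv' (by tauto)).imp_right (hb v hv)
    · exact .inr (hsc v hv' hv)
  refine ⟨a, c, p, q, r.append s.reverse, hac, hp, hq, hpath, hpo, hqe, ?_, ?_, hpq,
    fun v hv => hdis v (.inl hv), fun v hv => hdis v (.inr hv)⟩
  · simpa using hro.add_even hse
  · rw [Walk.length_append, Walk.length_reverse]
    have : r.length ≠ 0 := fun h => by simp [h] at hro
    rcases hlen with h | h
    · omega
    · have : s.length ≠ 0 := fun h' => h (Walk.eq_of_length_eq_zero h').symm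
      have := hse.two_dvd
      omega

/-- The two cut hypotheses say that `G`, and `G` with a node `x` removed, are connected. -/
theorem hasOddTheta_or_isHamiltonian_odd_cycle [Finite W] [Nontrivial W]
    (hM : ∀ v, ∃ m, G.MatchesOff m {v})
    (hcut : ∀ S : Set W, S.Nonempty → (∃ z, z ∉ S) → ∃ a ∈ S, ∃ b ∉ S, G.Adj a b)
    (hcut' : ∀ (x : W) (S : Set W), x ∉ S → S.Nonempty → (∃ z ∉ S, z ≠ x) →
      ∃ a ∈ S, ∃ b ∉ S, b ≠ x ∧ G.Adj a b) :
    G.HasOddTheta ∨ ∃ (x : W) (C : G.Walk x x), C.IsCycle ∧ Odd C.length ∧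
      (∀ v, v ∈ C.support) ∧ ∀ u v, G.Adj u v → s(u, v) ∈ C.edges := by
  classical
  by_contra! hcon
  obtain ⟨hT, hH⟩ := hcon
  -- a proper cycle-linked set with perfectly matched complement can be enlarged to another one
  have step : ∀ Q : Set W, Q.Nonempty → (∃ z, z ∉ Q) → G.CycleLinked Q →
      (∃ m, G.MatchesOff m Q) → ∃ Q', Q ⊂ Q' ∧ (∃ z, z ∉ Q') ∧ G.CycleLinked Q' ∧
        ∃ m, G.MatchesOff m Q' := by
    rintro Q hne hz hQ ⟨m, hm⟩
    obtain ⟨x, hx, y, hy, hxy⟩ := hcut Q hne hz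
    obtain ⟨N, hN⟩ := hM y
    obtain ⟨z, hzQ, p, hp, hpe, hpQ, hpm⟩ := hm.exists_alternating_path hN hy
    have hzy : z ≠ y := fun h => hy (h ▸ hzQ)
    have hpl : 2 ≤ p.length := by
      have h0 : p.length ≠ 0 := fun h => hzy (Walk.eq_of_length_eq_zero h)
      have := hpe.two_dvd
      omega
    by_cases hxz : x = z
    swap
    -- the edge `xy` and the path form an open odd ear of length at least three
    · obtain ⟨c, p', q, s, hac, hp', hq, hs, hpo, hqe, hse, hpq, hi, hpQ', hqQ, hsQ⟩ :=
        hQ x hx z hzQ hxz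
      refine absurd (hasOddTheta_of_ear (r := Walk.cons hxy p.reverse) hac hp' hq hs ?_ hpo hqe hse
        (by simpa using hpe.add_one) hpq hi ?_ (.inl (by simpa using hpl))) hT
      · refine hp.reverse.cons fun h => hxz (hpQ x (by simpa using h) hx)
      · intro v hv h
        have hvQ : v ∈ Q := h.elim (hpQ' v) fun h => h.elim (hqQ v) (hsQ v)
        simp only [Walk.support_cons, Walk.support_reverse, List.mem_cons, List.mem_reverse] at hv
        exact hv.imp_right fun hv => hpQ v hv hvQ
    -- the edge `xy` and the path form an odd cycle `C` through `x`, a closed ear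
    subst hxz
    obtain ⟨C, hC⟩ : ∃ C : G.Walk y y, C = Walk.cons hxy.symm p := ⟨_, rfl⟩
    have hCs : ∀ v, v ∈ C.support ↔ v ∈ p.support := by
      intro v
      rw [hC, Walk.support_cons, List.mem_cons, or_iff_right_of_imp]
      rintro rfl
      exact p.end_mem_support
    have hCc : C.IsCycle := by
      rw [Walk.isCycle_iff_isPath_tail_and_le_length, hC]
      exact ⟨by simpa using hp, by simpa using hpl⟩
    have hCo : Odd C.length := by
      rw [hC]
      simpa using hpe.add_one
    have hxC : x ∈ C.support := (hCs x).2 p.start_mem_support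
    have hyC : y ∈ C.support := C.start_mem_support
    have hCQ : ∀ v ∈ C.support, v ∈ Q → v = x := fun v hv => hpQ v ((hCs v).1 hv)
    refine ⟨Q ∪ {v | v ∈ C.support}, ?_, ?_, hQ.union_cycle hCc hCo hx hxC hCQ, m, ?_⟩
    · exact Set.ssubset_iff_subset_ne.2 ⟨Set.subset_union_left, fun h => hy (h ▸ .inr hyC)⟩
    · by_contra! hall
      by_cases hQx : ∃ b ∈ Q, b ≠ x
      -- `C` and `Q` cover everything: an edge avoiding the cut node `x` joins `C - x` to `Q - x`
      · obtain ⟨b, hb, hbx⟩ := hQx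
        obtain ⟨a, haQ, b, hbQ, hbx, hab⟩ := hcut' x Qᶜ (by simpa using hx) ⟨y, hy⟩
          ⟨b, by simpa using hb, hbx⟩
        rw [Set.notMem_compl_iff] at hbQ
        have haC : a ∈ C.support := (hall a).resolve_left haQ
        have hax : a ≠ x := fun h => haQ (h ▸ hx)
        obtain ⟨p, q, hp, hq, hpo, hqe, hpq, hpC, hqC, -⟩ :=
          hCc.exists_paths_of_odd hCo haC hxC hax
        obtain ⟨s, hs, hse, hsQ⟩ := hQ.exists_even_path hx hbQ
        refine hT (hasOddTheta_of_ear (r := hab.toWalk) hax hp hq hs ?_ hpo hqe hse (by simp) hpq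
          ?_ (by simp) (.inr hbx))
        · simpa using hab.ne
        · exact fun v hv h => h.elim (fun h => hCQ v (hpC v h) (hsQ v hv))
            (fun h => hCQ v (hqC v h) (hsQ v hv))
      -- `Q = {x}` and `C` is Hamiltonian: a chord of `C` gives a theta
      · push Not at hQx
        have hCall : ∀ v, v ∈ C.support := fun v =>
          (hall v).elim (fun h => hQx v h ▸ hxC) id
        obtain ⟨u, v, huv, hne⟩ := hH y C hCc hCo hCall
        obtain ⟨p, q, hp, hq, hpo, hqe, hpq, -, -, hp1⟩ :=
          hCc.exists_paths_of_odd hCo (hCall u) (hCall v) huv.ne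
        have hpl1 : p.length ≠ 1 := fun h => hne (hp1 h)
        have hdis : ∀ {r : G.Walk u v}, huv.toWalk.InternallyDisjoint r := by
          intro r w hw _
          simpa using hw
        refine hT ⟨u, v, huv.toWalk, q, p, huv.ne, by simpa using huv.ne, hq, hp, by simp, hqe, hpo,
          ?_, hdis, hdis, fun w h1 h2 => hpq w h2 h1⟩
        obtain ⟨k, hk⟩ := hpo
        omega
    · intro u hu
      have hu1 : u ∉ Q := fun h => hu (.inl h)
      have hu2 : u ∉ C.support := fun h => hu (.inr h)
      obtain ⟨h1, h2, h3⟩ := hm u hu1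
      refine ⟨?_, h2, h3⟩
      rintro (h | h)
      · exact h1 h
      · have := (hpm (m u) ((hCs _).1 h) h1).1
        rw [h3] at this
        exact hu2 ((hCs u).2 this)
  have : ∀ n : ℕ, ∃ Q : Set W, n ≤ Q.ncard ∧ Q.Nonempty ∧ (∃ z, z ∉ Q) ∧ G.CycleLinked Q ∧
      ∃ m, G.MatchesOff m Q := by
    intro n
    induction n with
    | zero =>
      obtain ⟨v, w, hvw⟩ := exists_pair_ne W
      refine ⟨{v}, by simp, by simp, ⟨w, by simpa using hvw.symm⟩, ?_, hM v⟩
      intro a ha b hb hab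
      exact absurd (ha.trans hb.symm) hab
    | succ n ih =>
      obtain ⟨Q, hn, hne, hz, hQ, hm⟩ := ih
      obtain ⟨Q', hss, hz', hQ', hm'⟩ := step Q hne hz hQ hm
      exact ⟨Q', by have := Set.ncard_lt_ncard hss; omega, hne.mono hss.subset, hz', hQ', hm'⟩
  obtain ⟨Q, hn, -⟩ := this (Nat.card W + 1)
  have := Set.ncard_le_card Q
  omega

end SimpleGraph

/-! ### From walks to subgraphs of a multigraph -/

namespace Graph

variable {α β : Type*} {H : Graph α β}

/-- Any set of edges together with any set of nodes containing all their ends is a subgraph. -/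
theorem exists_le_of_subset (X : Set α) (F : Set β) (hX : X ⊆ V(H)) (hF : F ⊆ E(H))
    (hXF : ∀ e ∈ F, ∀ x y, H.IsLink e x y → x ∈ X) :
    ∃ K ≤ H, V(K) = X ∧ E(K) = F ∧ ∀ e x y, K.IsLink e x y ↔ e ∈ F ∧ H.IsLink e x y :=
  ⟨{  vertexSet := X
      edgeSet := F
      IsLink := fun e x y => e ∈ F ∧ H.IsLink e x y
      isLink_symm := fun _ _ => ⟨fun _ _ h => ⟨h.1, h.2.symm⟩⟩
      eq_or_eq_of_isLink_of_isLink := fun _ _ _ _ _ h h' => h.2.left_eq_or_eq h'.2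
      edge_mem_iff_exists_isLink := fun _ =>
        ⟨fun he => (H.exists_isLink_of_mem_edgeSet (hF he)).imp fun _ => .imp fun _ h => ⟨he, h⟩,
          fun ⟨_, _, h⟩ => h.1⟩
      left_mem_of_isLink := fun _ x y h => hXF _ h.1 x y h.2 },
    ⟨hX, fun _ _ _ h => h.2⟩, rfl, rfl, fun _ _ _ => Iff.rfl⟩

/-- The underlying simple graph of a loopless multigraph, on the subtype of its nodes: parallel
edges are identified. -/
def underlying (H : Graph α β) [H.Loopless] : SimpleGraph V(H) where
  Adj x y := H.Adj x y
  symm := ⟨fun _ _ h => h.symm⟩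
  loopless := ⟨fun x h => H.not_adj_self x h⟩

/-- A cycle of the underlying simple graph is realized in `H` by choosing one edge for each pair of
consecutive nodes. -/
theorem exists_isCycleOfLength_of_isCycle [H.Loopless] {x : V(H)} {C : H.underlying.Walk x x}
    (hC : C.IsCycle) : ∃ K ≤ H, K.IsCycleOfLength C.length ∧
      V(K) = Subtype.val '' {v | v ∈ C.support} ∧
      ∀ u v : V(H), K.Adj u v ↔ s(u, v) ∈ C.edges := by
  set n := C.length with hn
  have h3 : 3 ≤ n := hC.three_le_length
  have : NeZero n := ⟨by omega⟩
  -- at the last index `n - 1` this holds because the walk returns to its start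
  have hsucc : ∀ i : ZMod n, C.getVert (i + 1).val = C.getVert (i.val + 1) := by
    intro i
    have hi := ZMod.val_lt i
    rw [ZMod.val_add, ZMod.val_one'' (by omega)]
    rcases Nat.lt_or_ge (i.val + 1) n with h | h
    · rw [Nat.mod_eq_of_lt h]
    · have h' : i.val + 1 = n := by omega
      rw [h', Nat.mod_self, C.getVert_zero, hn, C.getVert_length]
  have hadj : ∀ i : ZMod n, ∃ e, H.IsLink e (C.getVert i.val) (C.getVert (i + 1).val) := by
    intro i
    rw [hsucc]
    exact C.adj_getVert_succ (ZMod.val_lt i)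
  choose e he using hadj
  have hinj : Function.Injective fun i : ZMod n => (C.getVert i.val : α) := by
    intro i j hij
    refine ZMod.val_injective n (hC.getVert_injOn' ?_ ?_ (Subtype.ext hij))
    · have := ZMod.val_lt i
      simp only [Set.mem_ofPred_eq]; omega
    · have := ZMod.val_lt j
      simp only [Set.mem_ofPred_eq]; omega
  have hsup : ∀ v, v ∈ C.support ↔ ∃ i : ZMod n, C.getVert i.val = v := by
    intro v
    refine ⟨fun hv => ?_, fun ⟨i, hi⟩ => hi ▸ C.getVert_mem_support _⟩
    obtain ⟨k, hk, hkn⟩ := SimpleGraph.Walk.mem_support_iff_exists_getVert.1 hv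
    rcases hkn.lt_or_eq with h | h
    · exact ⟨(k : ZMod n), by rwa [ZMod.val_natCast_of_lt h]⟩
    · exact ⟨0, by rw [ZMod.val_zero, C.getVert_zero, ← hk, h, C.getVert_length]⟩
  obtain ⟨K, hK, hKV, hKE, hKL⟩ := H.exists_le_of_subset
    (Set.range fun i : ZMod n => (C.getVert i.val : α)) (Set.range e)
    (by rintro _ ⟨i, rfl⟩; exact (C.getVert i.val).2) (by rintro _ ⟨i, rfl⟩; exact (he i).edge_mem)
    (by
      rintro _ ⟨i, rfl⟩ u v huv
      rcases huv.left_eq_or_eq (he i) with rfl | rfl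
      exacts [⟨i, rfl⟩, ⟨i + 1, rfl⟩])
  refine ⟨K, hK, ⟨h3, _, e, hinj, ?_, hKV, hKE, fun i => (hKL _ _ _).2 ⟨⟨i, rfl⟩, he i⟩⟩, ?_, ?_⟩
  · intro i j hij
    rcases (he i).eq_and_eq_or_eq_and_eq (hij ▸ he j) with ⟨h, -⟩ | ⟨h, h'⟩
    · exact hinj h
    -- opposite orientations would give `2 = 0` in `ZMod n`, although `n ≥ 3`
    · have h1 : i = j + 1 := hinj h
      have h2 : i + 1 = j := hinj h'
      have h3' : ((2 : ℕ) : ZMod n) = 0 := by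
        have : j + 1 + 1 = j := by rw [← h1, h2]
        rw [add_assoc, add_eq_left] at this
        rw [← this]; norm_num
      rw [ZMod.natCast_eq_zero_iff] at h3'
      have := Nat.le_of_dvd (by norm_num) h3'
      omega
  · rw [hKV]
    ext a
    simp only [Set.mem_range, Set.mem_image, Set.mem_ofPred_eq, hsup]
    grind
  · intro u v
    rw [SimpleGraph.Walk.mk_mem_edges_iff_exists]
    constructor
    · rintro ⟨f, hf⟩
      obtain ⟨⟨i, rfl⟩, hf⟩ := (hKL _ _ _).1 hf
      refine ⟨i.val, ZMod.val_lt i, ?_⟩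
      rw [← hsucc]
      rw [(he i).isLink_iff_sym2_eq] at hf
      exact Sym2.map.injective Subtype.val_injective (by simpa using hf)
    · rintro ⟨k, hk, hkuv⟩
      refine ⟨e (k : ZMod n), (hKL _ _ _).2 ⟨⟨_, rfl⟩, ?_⟩⟩
      rw [(he _).isLink_iff_sym2_eq, hsucc, ZMod.val_natCast_of_lt hk]
      exact congrArg (Sym2.map Subtype.val) hkuv

theorem exists_isPathOfLength_of_isPath [H.Loopless] {a b : V(H)} {p : H.underlying.Walk a b}
    (hp : p.IsPath) : ∃ P ≤ H, P.IsPathOfLength p.length a b ∧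
      V(P) = Subtype.val '' {v | v ∈ p.support} ∧
      ∀ u v : V(H), P.Adj u v → s(u, v) ∈ p.edges := by
  have hadj : ∀ i : Fin p.length, ∃ e, H.IsLink e (p.getVert i.val) (p.getVert (i.val + 1)) :=
    fun i => p.adj_getVert_succ i.2
  choose e he using hadj
  have hinj : ∀ i ≤ p.length, ∀ j ≤ p.length, (p.getVert i : α) = p.getVert j → i = j :=
    fun i hi j hj hij => hp.getVert_injOn hi hj (Subtype.ext hij)
  obtain ⟨P, hP, hPV, hPE, hPL⟩ := H.exists_le_of_subset
    (Set.range fun i : Fin (p.length + 1) => (p.getVert i.val : α)) (Set.range e)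
    (by rintro _ ⟨i, rfl⟩; exact (p.getVert i.val).2) (by rintro _ ⟨i, rfl⟩; exact (he i).edge_mem)
    (by
      rintro _ ⟨i, rfl⟩ u v huv
      rcases huv.left_eq_or_eq (he i) with rfl | rfl
      exacts [⟨i.castSucc, rfl⟩, ⟨i.succ, rfl⟩])
  refine ⟨P, hP, ⟨_, e, ?_, ?_, ?_, ?_, hPV, hPE, fun i => (hPL _ _ _).2 ⟨⟨i, rfl⟩, he i⟩⟩, ?_, ?_⟩
  · exact fun i j hij => Fin.ext (hinj _ (by omega) _ (by omega) hij)
  · intro i j hij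
    rcases (he i).eq_and_eq_or_eq_and_eq (hij ▸ he j) with ⟨h, -⟩ | ⟨h, h'⟩
    · exact Fin.ext (hinj _ (by omega) _ (by omega) h)
    · have h1 := hinj _ (by omega) _ (by omega) h
      have h2 := hinj _ (by omega) _ (by omega) h'
      omega
  · simp
  · simp
  · rw [hPV]
    ext a
    simp only [Set.mem_range, Set.mem_image, Set.mem_ofPred_eq,
      SimpleGraph.Walk.mem_support_iff_exists_getVert]
    constructor
    · rintro ⟨i, rfl⟩
      exact ⟨_, ⟨i.val, rfl, by omega⟩, rfl⟩
    · rintro ⟨_, ⟨i, rfl, hi⟩, rfl⟩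
      exact ⟨⟨i, by omega⟩, rfl⟩
  · rintro u v ⟨f, hf⟩
    rw [SimpleGraph.Walk.mk_mem_edges_iff_exists]
    obtain ⟨⟨i, rfl⟩, hf⟩ := (hPL _ _ _).1 hf
    refine ⟨i.val, i.2, ?_⟩
    rw [(he i).isLink_iff_sym2_eq] at hf
    exact Sym2.map.injective Subtype.val_injective (by simpa using hf)

/-- An edge with distinct ends is a path of length one. -/
theorem exists_isPathOfLength_one {e : β} {x y : α} (he : H.IsLink e x y) (hxy : x ≠ y) :
    ∃ P ≤ H, P.IsPathOfLength 1 x y ∧ V(P) = {x, y} ∧ E(P) = {e} := by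
  obtain ⟨P, hP, hPV, hPE, hPL⟩ := H.exists_le_of_subset {x, y} {e}
    (by rintro _ (rfl | rfl); exacts [he.left_mem, he.right_mem])
    (by rintro _ rfl; exact he.edge_mem)
    (by rintro _ rfl u v huv; exact huv.left_eq_or_eq he)
  refine ⟨P, hP, ⟨![x, y], ![e], ?_, Function.injective_of_subsingleton _, rfl, rfl, ?_, ?_, ?_⟩,
    hPV, hPE⟩
  · intro i j hij
    fin_cases i <;> fin_cases j <;> simp_all
  · simp [hPV, Set.pair_comm]
  · simp [hPE]
  · intro i
    fin_cases i
    exact (hPL _ _ _).2 ⟨rfl, he⟩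

/-! ### Odd holes with an attached path -/

/-- Inside `H`, an odd hole and a path meeting it only in the two ends of the path have a union. -/
theorem IsOddHole.exists_isOddHoleWithPath {C P : Graph α β} (hC : C.IsOddHole) (hCH : C ≤ H)
    (hPH : P ≤ H) {l : ℕ} {x y : α} (hP : P.IsPathOfLength l x y) (hxy : x ≠ y)
    (hV : V(C) ∩ V(P) = {x, y}) (hE : Disjoint E(C) E(P)) :
    ∃ K ≤ H, K.IsOddHoleWithPath C l x y := by
  obtain ⟨K, hK, hKV, hKE, hKL⟩ := H.exists_le_of_subset (V(C) ∪ V(P)) (E(C) ∪ E(P))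
    (Set.union_subset hCH.vertexSet_mono hPH.vertexSet_mono)
    (Set.union_subset hCH.edgeSet_mono hPH.edgeSet_mono)
    (by
      rintro e (he | he) u v huv
      · exact .inl ((hCH.isLink_iff he).2 huv).left_mem
      · exact .inr ((hPH.isLink_iff he).2 huv).left_mem)
  exact ⟨K, hK, hC, ⟨hKV ▸ Set.subset_union_left,
    fun e u v h => (hKL _ _ _).2 ⟨.inl h.edge_mem, h.mono hCH⟩⟩, hxy, P,
    ⟨hKV ▸ Set.subset_union_right, fun e u v h => (hKL _ _ _).2 ⟨.inr h.edge_mem, h.mono hPH⟩⟩,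
    hP, hV, hE, hKV, hKE⟩

/-- In an odd theta, the even path `q` and the long odd path `r` form an odd hole, in which the ends
of the theta are not adjacent; the other odd path `p` is a chord or a long ear of it. -/
theorem exists_oddHole_with_ear_of_hasOddTheta [H.Loopless] (h : H.underlying.HasOddTheta) :
    ∃ K ≤ H, K.IsOddHoleWithChord ∨ K.IsOddHoleWithLongEar := by
  obtain ⟨a, b, p, q, r, hab, hp, hq, hr, hpo, hqe, hro, hr3, hpq, hpr, hqr⟩ := h
  have hq2 : 2 ≤ q.length := by
    have h0 : q.length ≠ 0 := fun h => hab (SimpleGraph.Walk.eq_of_length_eq_zero h)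
    have := hqe.two_dvd
    omega
  have hcyc : (q.append r.reverse).IsCycle := by
    refine hq.isCycle_append hr.reverse (fun v hv hv' => ?_) (.inl hq2)
    have hv1 := hq.support_nodup
    have hv2 := hr.reverse.support_nodup
    rw [← SimpleGraph.Walk.cons_tail_support, List.nodup_cons] at hv1 hv2
    rcases hqr v (List.mem_of_mem_tail hv) (by simpa using List.mem_of_mem_tail hv') with rfl | rfl
    exacts [hv1.1 hv, hv2.1 hv']
  have hnab : s(a, b) ∉ (q.append r.reverse).edges := by
    simp only [SimpleGraph.Walk.edges_append, SimpleGraph.Walk.edges_reverse, List.mem_append,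
      List.mem_reverse, not_or]
    refine ⟨fun h => ?_, fun h => ?_⟩
    · have := hq.length_eq_one_of_mem_edges h; omega
    · have := hr.length_eq_one_of_mem_edges h; omega
  have hsup : ∀ v, v ∈ (q.append r.reverse).support → v ∈ p.support → v = a ∨ v = b := by
    intro v hv hv'
    simp only [SimpleGraph.Walk.mem_support_append_iff, SimpleGraph.Walk.support_reverse,
      List.mem_reverse] at hv
    exact hv.elim (hpq v hv') (hpr v hv')
  have haC : a ∈ (q.append r.reverse).support := SimpleGraph.Walk.start_mem_support _
  have hbC : b ∈ (q.append r.reverse).support := by simp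
  obtain ⟨C, hCH, hC, hCV, hCA⟩ := exists_isCycleOfLength_of_isCycle hcyc
  obtain ⟨P, hPH, hP, hPV, hPA⟩ := exists_isPathOfLength_of_isPath hp
  have hCab : ¬ C.Adj a b := fun h => hnab ((hCA a b).1 h)
  have hCo : C.IsOddHole := by
    obtain ⟨k, hk⟩ := hqe.add_odd hro
    refine ⟨k, by omega, ?_⟩
    rw [← hk]
    simpa using hC
  obtain ⟨K, hK, hKo⟩ := hCo.exists_isOddHoleWithPath hCH hPH hP (fun h => hab (Subtype.ext h))
    (by
      rw [hCV, hPV, ← Set.image_inter Subtype.val_injective, ← Set.image_pair]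
      congr 1
      ext v
      refine ⟨fun hv => hsup v hv.1 hv.2, ?_⟩
      rintro (rfl | rfl)
      exacts [⟨haC, p.start_mem_support⟩, ⟨hbC, p.end_mem_support⟩])
    (by
      rw [Set.disjoint_left]
      intro e he he'
      obtain ⟨u, v, huv⟩ := C.exists_isLink_of_mem_edgeSet he
      have huvH := huv.mono hCH
      have huvP := (hPH.isLink_iff he').2 huvH
      lift u to V(H) using huvH.left_mem
      lift v to V(H) using huvH.right_mem
      have h1 := (hCA u v).1 huv.adj
      have h2 := hPA u v huvP.adj
      have hu := hsup u (SimpleGraph.Walk.fst_mem_support_of_mem_edges _ h1)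
        (SimpleGraph.Walk.fst_mem_support_of_mem_edges _ h2)
      have hv := hsup v (SimpleGraph.Walk.snd_mem_support_of_mem_edges _ h1)
        (SimpleGraph.Walk.snd_mem_support_of_mem_edges _ h2)
      have hne : u ≠ v := (SimpleGraph.Walk.adj_of_mem_edges _ h1).ne
      rcases hu with rfl | rfl <;> rcases hv with rfl | rfl
      · exact hne rfl
      · exact hnab h1
      · exact hnab (Sym2.eq_swap ▸ h1)
      · exact hne rfl)
  refine ⟨K, hK, ?_⟩
  by_cases h1 : p.length = 1
  · exact .inl ⟨C, a, b, h1 ▸ hKo, hCab⟩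
  · refine .inr ⟨C, _, a, b, hpo, ?_, hKo, hCab⟩
    obtain ⟨k, hk⟩ := hpo
    omega

theorem IsCycleOfLength.ncard_vertexSet {C : Graph α β} {n : ℕ} (hC : C.IsCycleOfLength n) :
    V(C).ncard = n := by
  obtain ⟨-, v, e, hv, -, hV, -⟩ := hC
  rw [hV, Set.ncard_range_of_injective hv, Nat.card_zmod]

theorem IsOddHole.five_le_ncard {C : Graph α β} (hC : C.IsOddHole) : 5 ≤ V(C).ncard := by
  obtain ⟨k, hk, hC⟩ := hC
  rw [hC.ncard_vertexSet]
  omega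

/-! ### An odd hole contains none of the configurations -/

theorem IsCycleOfLength.exists_inc_ne {C : Graph α β} {n : ℕ} (hC : C.IsCycleOfLength n) {x : α}
    (hx : x ∈ V(C)) : ∃ e f, e ≠ f ∧ C.Inc e x ∧ C.Inc f x := by
  obtain ⟨hn, v, e, hv, he, hV, hE, hL⟩ := hC
  obtain ⟨i, rfl⟩ := hV ▸ hx
  have : Fact (1 < n) := ⟨by omega⟩
  refine ⟨e i, e (i - 1), fun h => one_ne_zero (sub_eq_self.1 (he h).symm), (hL i).inc_left, ?_⟩
  · have := (hL (i - 1)).inc_right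
    rwa [sub_add_cancel] at this

/-- A cycle contained in a cycle is all of it: each node of the smaller one has two edges there, and
only two edges of the larger one are available, so the smaller one contains with every node the
edge to its successor. -/
theorem IsCycleOfLength.edgeSet_subset_of_le {C : Graph α β} {m n : ℕ} (hH : H.IsCycleOfLength n)
    (hC : C.IsCycleOfLength m) (hCH : C ≤ H) : E(H) ⊆ E(C) := by
  have hC' := hC
  obtain ⟨hn, v, e, hv, he, hV, hE, hL⟩ := hH
  obtain ⟨hm, w, -, -, -, hCV, -⟩ := hC
  have : NeZero n := ⟨by omega⟩
  have hinc : ∀ f i, H.Inc f (v i) → f = e i ∨ f = e (i - 1) := by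
    intro f i hf
    obtain ⟨j, rfl⟩ := hE ▸ hf.edge_mem
    rcases hf.eq_or_eq_of_isLink (hL j) with h | h
    · exact .inl (congrArg e (hv h).symm)
    · exact .inr (by rw [hv h, add_sub_cancel_right])
  have hedge : ∀ i, v i ∈ V(C) → e i ∈ E(C) := by
    intro i hi
    obtain ⟨f, g, hfg, hf, hg⟩ := hC'.exists_inc_ne hi
    rcases hinc f i (hf.mono hCH) with h | h
    · exact h ▸ hf.edge_mem
    rcases hinc g i (hg.mono hCH) with h' | h'
    · exact h' ▸ hg.edge_mem
    · exact absurd (h.trans h'.symm) hfg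
  have hsucc : ∀ i, v i ∈ V(C) → v (i + 1) ∈ V(C) := fun i hi =>
    ((hCH.isLink_iff (hedge i hi)).2 (hL i)).right_mem
  have hw : w 0 ∈ V(C) := hCV ▸ ⟨0, rfl⟩
  obtain ⟨i₀, hi₀⟩ := hV ▸ hCH.vertexSet_mono hw
  have hall : ∀ k : ℕ, v (i₀ + k) ∈ V(C) := by
    intro k
    induction k with
    | zero => simpa [hi₀] using hw
    | succ k ih => simpa [add_assoc] using hsucc _ ih
  rw [hE]
  rintro _ ⟨i, rfl⟩
  refine hedge i ?_
  have := hall (i - i₀).val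
  rwa [ZMod.natCast_zmod_val, add_sub_cancel] at this

theorem IsPathOfLength.edgeSet_nonempty {P : Graph α β} {l : ℕ} {x y : α}
    (hP : P.IsPathOfLength l x y) (hxy : x ≠ y) : E(P).Nonempty := by
  obtain ⟨v, e, -, -, rfl, rfl, -, hE, -⟩ := hP
  rcases Nat.eq_zero_or_pos l with rfl | hl
  · exact absurd rfl hxy
  · exact hE ▸ ⟨_, ⟨⟨0, hl⟩, rfl⟩⟩

/-- The attached path has an edge outside the hole `C`, but if `H` is itself an odd hole, then `C`
contains all its edges. -/
theorem IsOddHoleWithPath.not_isOddHole {K C : Graph α β} {l : ℕ} {x y : α}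
    (hK : K.IsOddHoleWithPath C l x y) (hKH : K ≤ H) : ¬ H.IsOddHole := by
  rintro ⟨k, -, hH⟩
  obtain ⟨⟨j, -, hC⟩, hCK, hxy, P, hPK, hP, -, hE, -⟩ := hK
  obtain ⟨e, he⟩ := hP.edgeSet_nonempty hxy
  exact Set.disjoint_left.1 hE
    (hH.edgeSet_subset_of_le hC (hCK.trans hKH) (hKH.edgeSet_mono (hPK.edgeSet_mono he))) he

theorem exists_isOddHoleWithPath_of_configuration {K : Graph α β}
    (h : K.IsOddHoleWithDoubleEdge ∨ K.IsOddHoleWithChord ∨ K.IsOddHoleWithLongEar) :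
    ∃ C l x y, K.IsOddHoleWithPath C l x y := by
  rcases h with ⟨C, x, y, h, -⟩ | ⟨C, x, y, h, -⟩ | ⟨C, l, x, y, -, -, h, -⟩
  exacts [⟨C, 1, x, y, h⟩, ⟨C, 1, x, y, h⟩, ⟨C, l, x, y, h⟩]

/-! ### 2-connected hypomatchable multigraphs -/

/-- The perfect matching of `H - v`, as the map sending each node to its partner. -/
theorem IsHypomatchable.exists_matchesOff [H.Loopless] (hH : H.IsHypomatchable) (v : V(H)) :
    ∃ m, H.underlying.MatchesOff m {v} := by
  obtain ⟨M, -, -, hM⟩ := hH v v.2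
  have hex : ∀ u : V(H), ∃ w : V(H), u ≠ v → ∃ e ∈ M, (H.deleteVerts {v.1}).IsLink e u w := by
    intro u
    by_cases huv : u = v
    · exact ⟨u, fun h => absurd huv h⟩
    · obtain ⟨e, ⟨he, w, hw⟩, -⟩ := hM u (by
        rw [vertexSet_deleteVerts]
        exact ⟨u.2, fun h => huv (Subtype.ext h)⟩)
      exact ⟨⟨w, (hw.mono deleteVerts_le).right_mem⟩, fun _ => ⟨e, he, hw⟩⟩
  choose m hm using hex
  refine ⟨m, fun u hu => ?_⟩
  obtain ⟨e, he, hl⟩ := hm u hu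
  have hmem := hl.right_mem
  have hmv : m u ≠ v := by
    rw [vertexSet_deleteVerts] at hmem
    exact fun h => hmem.2 (congrArg Subtype.val h)
  refine ⟨hmv, ⟨e, hl.mono deleteVerts_le⟩, ?_⟩
  obtain ⟨f, hf, hl'⟩ := hm (m u) hmv
  obtain rfl : e = f := (hM _ hmem).unique ⟨he, hl.inc_right⟩ ⟨hf, hl'.inc_left⟩
  exact Subtype.ext (hl'.right_unique hl.symm)

theorem _root_.Relation.ReflTransGen.exists_rel_of_not {r : α → α → Prop} {P : α → Prop} {x y : α}
    (h : Relation.ReflTransGen r x y) (hx : P x) (hy : ¬ P y) : ∃ a b, P a ∧ ¬ P b ∧ r a b := by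
  induction h with
  | refl => exact absurd hx hy
  | @tail b c _ hbc ih =>
    by_cases hb : P b
    · exact ⟨b, c, hb, hy, hbc⟩
    · exact ih hb

/-- In a connected multigraph some edge crosses each cut. -/
theorem IsConnected.exists_adj_of_cut (hH : H.IsConnected) {S : Set α} {x y : α} (hx : x ∈ V(H))
    (hxS : x ∈ S) (hy : y ∈ V(H)) (hyS : y ∉ S) : ∃ a ∈ S, ∃ b ∉ S, H.Adj a b := by
  obtain ⟨a, b, ha, hb, hab⟩ := (hH.2 x hx y hy).exists_rel_of_not (P := (· ∈ S)) hxS hyS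
  exact ⟨a, ha, b, hb, hab⟩

theorem IsTwoConnected.hasOddTheta_or_isHamiltonian [H.Loopless] (hV : V(H).Finite)
    (h2 : H.IsTwoConnected) (hH : H.IsHypomatchable) :
    H.underlying.HasOddTheta ∨ ∃ (x : V(H)) (C : H.underlying.Walk x x), C.IsCycle ∧
      Odd C.length ∧ (∀ v, v ∈ C.support) ∧ ∀ u v, H.underlying.Adj u v → s(u, v) ∈ C.edges := by
  have := hV.to_subtype
  have : Nontrivial V(H) := by
    obtain ⟨v, hv⟩ := h2.1.1
    obtain ⟨w, hw⟩ := (h2.2 v hv).1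
    rw [vertexSet_deleteVerts] at hw
    exact ⟨⟨v, hv⟩, ⟨w, hw.1⟩, fun h => hw.2 (congrArg Subtype.val h).symm⟩
  refine SimpleGraph.hasOddTheta_or_isHamiltonian_odd_cycle hH.exists_matchesOff ?_ ?_
  · rintro S ⟨x, hx⟩ ⟨z, hz⟩
    obtain ⟨_, ⟨a, ha, rfl⟩, b, hb, hab⟩ := h2.1.exists_adj_of_cut (S := Subtype.val '' S)
      x.2 ⟨x, hx, rfl⟩ z.2 (by simpa using hz)
    exact ⟨a, ha, ⟨b, hab.right_mem⟩, fun h => hb ⟨_, h, rfl⟩, hab⟩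
  · rintro x S hxS ⟨y, hy⟩ ⟨z, hz, hzx⟩
    have hmem : ∀ u : V(H), u ≠ x → u.1 ∈ V(H.deleteVerts {x.1}) := fun u hu => by
      rw [vertexSet_deleteVerts]
      exact ⟨u.2, fun h => hu (Subtype.ext h)⟩
    obtain ⟨_, ⟨a, ha, rfl⟩, b, hb, hab⟩ := (h2.2 x x.2).exists_adj_of_cut (S := Subtype.val '' S)
      (hmem y fun h => hxS (h ▸ hy)) ⟨y, hy, rfl⟩ (hmem z hzx) (by simpa using hz)
    have hbV := hab.right_mem
    rw [vertexSet_deleteVerts] at hbV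
    exact ⟨a, ha, ⟨b, hbV.1⟩, fun h => hb ⟨_, h, rfl⟩,
      fun h => hbV.2 (congrArg Subtype.val h), hab.mono deleteVerts_le⟩

/-- If the underlying simple graph is an odd cycle on more than three nodes, then `H` is that cycle
unless it has an edge parallel to one of the cycle. -/
theorem isOddHole_or_exists_isOddHoleWithDoubleEdge [H.Loopless] {x : V(H)}
    {C : H.underlying.Walk x x} (hC : C.IsCycle) (hodd : Odd C.length)
    (hall : ∀ v, v ∈ C.support) (hadj : ∀ u v, H.underlying.Adj u v → s(u, v) ∈ C.edges)
    (h3 : V(H).ncard ≠ 3) : H.IsOddHole ∨ ∃ K ≤ H, K.IsOddHoleWithDoubleEdge := by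
  obtain ⟨D, hDH, hD, hDV, hDA⟩ := exists_isCycleOfLength_of_isCycle hC
  have hVD : V(D) = V(H) := by
    rw [hDV]
    ext v
    simp [hall]
  have hDo : D.IsOddHole := by
    have hn := hD.ncard_vertexSet
    have := hC.three_le_length
    rw [hVD] at hn
    obtain ⟨k, hk⟩ := hodd
    exact ⟨k, by omega, hk ▸ hD⟩
  by_cases hE : E(H) ⊆ E(D)
  · left
    have : D = H := (Compatible.of_le hDH).ext hVD (hDH.edgeSet_mono.antisymm hE)
    exact this ▸ hDo
  · right
    obtain ⟨e, he, heD⟩ := Set.not_subset.1 hE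
    obtain ⟨u, v, huv⟩ := H.exists_isLink_of_mem_edgeSet he
    obtain ⟨P, hPH, hP, hPV, hPE⟩ := exists_isPathOfLength_one huv huv.ne
    obtain ⟨K, hK, hKo⟩ := hDo.exists_isOddHoleWithPath hDH hPH hP huv.ne
      (by rw [hVD, Set.inter_eq_right.2 hPH.vertexSet_mono, hPV]) (by simpa [hPE] using heD)
    exact ⟨K, hK, D, u, v, hKo,
      (hDA ⟨u, huv.left_mem⟩ ⟨v, huv.right_mem⟩).2 (hadj _ _ huv.adj)⟩

end Graph

theorem mainTheorem6 {α β : Type*} (H : Graph α β)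
    [H.Loopless] (hV : V(H).Finite) (hE : E(H).Finite)
    (h2 : H.IsTwoConnected) (hH : H.IsHypomatchable) :
    (V(H).ncard = 3 ∨ H.IsOddHole ∨ ∃ K : Graph α β, K ≤ H ∧
        (K.IsOddHoleWithDoubleEdge ∨ K.IsOddHoleWithChord ∨ K.IsOddHoleWithLongEar)) ∧
    ¬ (V(H).ncard = 3 ∧ H.IsOddHole) ∧
    ¬ (V(H).ncard = 3 ∧ ∃ K : Graph α β, K ≤ H ∧
        (K.IsOddHoleWithDoubleEdge ∨ K.IsOddHoleWithChord ∨ K.IsOddHoleWithLongEar)) ∧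
    ¬ (H.IsOddHole ∧ ∃ K : Graph α β, K ≤ H ∧
        (K.IsOddHoleWithDoubleEdge ∨ K.IsOddHoleWithChord ∨ K.IsOddHoleWithLongEar)) := by
  refine ⟨?_, ?_, ?_, ?_⟩
  · by_cases h3 : V(H).ncard = 3
    · exact .inl h3
    rcases h2.hasOddTheta_or_isHamiltonian hV hH with h | ⟨x, C, hC, hodd, hall, hadj⟩
    · obtain ⟨K, hK, h⟩ := Graph.exists_oddHole_with_ear_of_hasOddTheta h
      exact .inr (.inr ⟨K, hK, .inr h⟩)
    · rcases Graph.isOddHole_or_exists_isOddHoleWithDoubleEdge hC hodd hall hadj h3 with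
        h | ⟨K, hK, h⟩
      · exact .inr (.inl h)
      · exact .inr (.inr ⟨K, hK, .inl h⟩)
  · rintro ⟨h3, h⟩
    have := h.five_le_ncard
    omega
  · rintro ⟨h3, K, hK, h⟩
    obtain ⟨C, l, x, y, hC, hCK, -⟩ := Graph.exists_isOddHoleWithPath_of_configuration h
    have := hC.five_le_ncard
    have := Set.ncard_le_ncard (hCK.trans hK).vertexSet_mono hV
    omega
  · rintro ⟨hO, K, hK, h⟩
    obtain ⟨C, l, x, y, hC⟩ := Graph.exists_isOddHoleWithPath_of_configuration h
    exact hC.not_isOddHole hK hO
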